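/- \textbf{Lemma (Measurability criterion).} Let $\mathcal A$ be a von Neumann algebra, $\psi$ a faithful normal state on it, $\mathcal H_\psi$ the GNS Hilbert space with vacuum $|1\rangle_\psi$, let $S_\psi$ be the closure of $a|1\rangle_\psi\mapsto a^\dagger|1\rangle_\psi$, $\Delta_\psi=S_\psi^*S_\psi$ the modular operator and $\hat K=-\log\Delta_\psi$. Put $$f_{ab}(t)=\langle a\,1|\,\Delta_\psi^{1/2+it}\,|b\,1\rangle_\psi=\int e^{-(1/2+it)\omega}\,\langle a\,1|\,dP_{\hat K}(\omega)\,|b\,1\rangle_\psi ,\qquad t\in\mathbb R,$$ for (possibly unbounded) operators $a,b$ whose domain contains $\mathcal A'|1\rangle_\psi$ and for which $f_{aa}(0),f_{bb}(0)<\infty$, i.e. $a|1\rangle_\psi,b|1\rangle_\psi\in\mathrm{dom}\,\Delta_\psi^{1/4}$. Let $\mathcal X=\{\mathcal O_1,\mathcal O_2,\dots\}\subset\mathcal A$ be a countable set of bounded observables (self-adjoint elements); they may be, but need not be, pairwise orthogonal. Let $\mathbb O_i=\mathcal O_i-\psi(\mathcal O_i)1$ and $f_{ij}=f_{\mathbb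 O_i\mathbb O_j}$. Suppose that for all $i,j$ the Fourier transform $\hat f_{ij}$, a tempered distribution, is a Lebesgue-measurable function of the frequency: there is a Lebesgue-measurable $g_{ij}:\mathbb R\to\mathbb C$ with $g_{ij}\varphi\in L^1(\mathbb R)$ and $\langle\hat f_{ij},\varphi\rangle=\int g_{ij}\varphi\,d\omega$ for all $\varphi\in C_c^\infty(\mathbb R)$. Let $S^{\mathcal X}_\psi$, the operator system generated by $\mathcal X$, be the set of all operators $a=\alpha_0+\sum_i\alpha_i\mathcal O_i$ with $\alpha_0,\alpha_i\in\mathbb C$ and $f_{aa}(0)<\infty$ (where $a$ may be unbounded with domain containing $\mathcal A'|1\rangle_\psi$, and the partial sums converge weakly to $a$ on its domain). Then $S^{\mathcal X}_\psi$ is $\psi$-mixing: for all $a,b\in S^{\mathcal X}_\psi$, $$\lim_{t\to\pm\infty}\Bigl(f_{ab}(t)-\langle a\,1|1\rangle_\psi\,\langle 1|b\,1\rangle_\psi\Bigr)=0 .$$ -/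

import Mathlib

open Filter Topology MeasureTheory
open scoped ComplexOrder InnerProductSpace SchwartzMap FourierTransform CompactlySupported

noncomputable section

/-! ### Spectral measures of bounded self-adjoint operators -/

section SpectralMeasure

variable {H : Type*} [NormedAddCommGroup H] [InnerProductSpace ℂ H] [CompleteSpace H]

/-- The positive functional `g ↦ ⟨v, g(T) v⟩` on `C_c(ℝ)`, where `g(T)` is the continuous
functional calculus of the self-adjoint bounded operator `T`. -/
def spectralFunctional (T : H →L[ℂ] H) (v : H) : C_c(ℝ, ℝ) →ₚ[ℝ] ℝ :=
  PositiveLinearMap.mk₀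
    { toFun := fun g => (⟪v, (cfc (fun x => g x) T) v⟫_ℂ).re
      map_add' := by
        intro f g
        have h : cfc (fun x => (f + g) x) T = cfc (fun x => f x) T + cfc (fun x => g x) T :=
          cfc_add (R := ℝ) (a := T) (fun x => f x) (fun x => g x)
            f.continuous.continuousOn g.continuous.continuousOn
        rw [h]
        simp
      map_smul' := by
        intro c g
        have h : cfc (fun x => (c • g) x) T = c • cfc (fun x => g x) T :=
          cfc_smul (R := ℝ) (a := T) c (fun x => g x) g.continuous.continuousOn
        rw [h]
        simp [inner_smul_right_eq_smul] }
    (by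
      intro g hg
      have h : (0 : H →L[ℂ] H) ≤ cfc (fun x => g x) T :=
        cfc_nonneg (fun x _ => hg x)
      have h2 := ((ContinuousLinearMap.nonneg_iff_isPositive _).1 h).re_inner_nonneg_right v
      exact h2)

/-- The spectral measure `⟨v, dE_T(x) v⟩` of the bounded self-adjoint operator `T` at `v`: the
unique regular Borel measure on `ℝ` with `∫ g dμ = ⟨v, g(T) v⟩` for all `g ∈ C_c(ℝ)`. -/
def spectralMeasure (T : H →L[ℂ] H) (v : H) : Measure ℝ :=
  RealRMK.rieszMeasure (spectralFunctional T v)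

end SpectralMeasure

/-! ### States, GNS space, modular operator -/

section Modular

variable {M : Type*} [CStarAlgebra M] [PartialOrder M] [StarOrderedRing M]

/-- `ψ` is a faithful normal state. Normality: `ψ (sup D) = sup ψ(D)` for every upward directed
family `D` of positive elements that has a supremum. -/
structure IsFaithfulNormalState (ψ : M →ₚ[ℂ] ℂ) : Prop where
  map_one : ψ 1 = 1
  faithful : ∀ a : M, ψ (star a * a) = 0 → a = 0
  normal : ∀ D : Set M, D.Nonempty → (∀ d ∈ D, 0 ≤ d) → DirectedOn (· ≤ ·) D →
    ∀ s, IsLUB D s → IsLUB (ψ '' D) (ψ s)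

/-- The vector `|a⟩_ψ` of the GNS Hilbert space, as a linear function of `a`. -/
def ket (ψ : M →ₚ[ℂ] ℂ) (a : M) : ψ.GNS := ((ψ.toPreGNS a : ψ.PreGNS) : ψ.GNS)

/-- The GNS vacuum `|1⟩_ψ`. -/
def vacuum (ψ : M →ₚ[ℂ] ℂ) : ψ.GNS := ket ψ 1

/-- The graph of the closure of the Tomita operator `|a⟩ ↦ |a⋆⟩`. -/
def tomitaGraph (ψ : M →ₚ[ℂ] ℂ) : Set (ψ.GNS × ψ.GNS) :=
  closure (Set.range fun a : M => (ket ψ a, ket ψ (star a)))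

/-- The graph of the modular operator `Δ = S⋆ S`, with `S` the closed Tomita operator: `Δ v = u`
iff `v ∈ dom S`, and `w = S v` is in the domain of the adjoint of the antilinear operator `S`,
with `S⋆ w = u`, that is, `⟨w, S x⟩ = ⟨x, u⟩` for all `x` in the core `{|a⟩}` of `S`. -/
def modularGraph (ψ : M →ₚ[ℂ] ℂ) : Set (ψ.GNS × ψ.GNS) :=
  {p | ∃ w, (p.1, w) ∈ tomitaGraph ψ ∧
    ∀ a : M, ⟪w, ket ψ (star a)⟫_ℂ = ⟪ket ψ a, p.2⟫_ℂ}

variable (ψ : M →ₚ[ℂ] ℂ)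

lemma ket_add (a b : M) : ket ψ (a + b) = ket ψ a + ket ψ b := by
  simp [ket, UniformSpace.Completion.coe_add]

lemma ket_smul (c : ℂ) (a : M) : ket ψ (c • a) = c • ket ψ a := by
  simp [ket, UniformSpace.Completion.coe_smul]

lemma tomitaGraph_add {p q : ψ.GNS × ψ.GNS} (hp : p ∈ tomitaGraph ψ) (hq : q ∈ tomitaGraph ψ) :
    p + q ∈ tomitaGraph ψ := by
  refine map_mem_closure₂ continuous_add hp hq ?_
  rintro _ ⟨a, rfl⟩ _ ⟨b, rfl⟩
  exact ⟨a + b, by simp [ket_add]⟩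

lemma tomitaGraph_smul (c : ℂ) {p : ψ.GNS × ψ.GNS} (hp : p ∈ tomitaGraph ψ) :
    (c • p.1, star c • p.2) ∈ tomitaGraph ψ := by
  have hc : Continuous fun p : ψ.GNS × ψ.GNS => (c • p.1, star c • p.2) :=
    (continuous_fst.const_smul c).prodMk (continuous_snd.const_smul (star c))
  refine map_mem_closure (f := fun p : ψ.GNS × ψ.GNS => (c • p.1, star c • p.2)) hc hp ?_
  rintro _ ⟨a, rfl⟩
  exact ⟨c • a, by simp [ket_smul]⟩

lemma modularGraph_add {p q : ψ.GNS × ψ.GNS} (hp : p ∈ modularGraph ψ)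
    (hq : q ∈ modularGraph ψ) : p + q ∈ modularGraph ψ := by
  obtain ⟨w, hw, h⟩ := hp
  obtain ⟨w', hw', h'⟩ := hq
  exact ⟨w + w', tomitaGraph_add ψ hw hw', fun a => by
    simp [inner_add_left, inner_add_right, h, h']⟩

lemma modularGraph_smul (c : ℂ) {p : ψ.GNS × ψ.GNS} (hp : p ∈ modularGraph ψ) :
    c • p ∈ modularGraph ψ := by
  obtain ⟨w, hw, h⟩ := hp
  exact ⟨star c • w, tomitaGraph_smul ψ c hw, fun a => by
    simp [inner_smul_left, inner_smul_right, h]⟩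

/-- Positivity of the modular operator. -/
lemma modularGraph_pos {p : ψ.GNS × ψ.GNS} (hp : p ∈ modularGraph ψ) :
    0 ≤ (⟪p.1, p.2⟫_ℂ).re := by
  obtain ⟨w, hw, h⟩ := hp
  have key : ∀ q ∈ tomitaGraph ψ, ⟪w, q.2⟫_ℂ = ⟪q.1, p.2⟫_ℂ := by
    intro q hq
    refine closure_minimal (t := {q : ψ.GNS × ψ.GNS | ⟪w, q.2⟫_ℂ = ⟪q.1, p.2⟫_ℂ}) ?_
      (isClosed_eq (by fun_prop) (by fun_prop)) hq
    rintro _ ⟨a, rfl⟩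
    exact h a
  rw [← key _ hw]
  exact inner_self_nonneg (𝕜 := ℂ)

/-- `1 + Δ` is injective, with inverse of norm at most one. -/
lemma norm_le_of_mem_modularGraph {u v : ψ.GNS} (h : (u, v - u) ∈ modularGraph ψ) :
    ‖u‖ ≤ ‖v‖ := by
  have h1 := modularGraph_pos ψ h
  simp only [inner_sub_right, Complex.sub_re] at h1
  have h2 : (⟪u, u⟫_ℂ).re = ‖u‖ * ‖u‖ := by
    have := inner_self_eq_norm_mul_norm (𝕜 := ℂ) u
    simpa using this
  have h3 : (⟪u, v⟫_ℂ).re ≤ ‖u‖ * ‖v‖ := by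
    have := re_inner_le_norm (𝕜 := ℂ) u v
    simpa using this
  rcases (norm_nonneg u).eq_or_lt with h0 | h0
  · rw [← h0]; exact norm_nonneg v
  · nlinarith

/-- `1 + Δ` is surjective. -/
lemma exists_mem_modularGraph (v : ψ.GNS) : ∃ u, (u, v - u) ∈ modularGraph ψ := by
  let : InnerProductSpace ℝ (WithLp 2 (ψ.GNS × ψ.GNS)) := InnerProductSpace.rclikeToReal ℂ _
  let G : Submodule ℝ (WithLp 2 (ψ.GNS × ψ.GNS)) :=
    { carrier := {q | q.ofLp ∈ tomitaGraph ψ}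
      add_mem' := fun hp hq => tomitaGraph_add ψ hp hq
      zero_mem' := subset_closure ⟨0, by
        simp [ket, UniformSpace.Completion.coe_zero]⟩
      smul_mem' := fun c q hq => by
        have := tomitaGraph_smul ψ (c : ℂ) hq
        have h2 : star (c : ℂ) = c := by simp
        rw [h2] at this
        exact this }
  have hG : IsClosed (G : Set (WithLp 2 (ψ.GNS × ψ.GNS))) :=
    isClosed_closure.preimage (WithLp.prod_continuous_ofLp 2 _ _)
  have : CompleteSpace G := hG.completeSpace_coe
  set p := G.starProjection (WithLp.toLp 2 (v, 0)) with hp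
  have hpG : p.ofLp ∈ tomitaGraph ψ := G.starProjection_apply_mem _
  have horth : ∀ q ∈ G, (⟪WithLp.toLp 2 (v, 0) - p, q⟫_ℂ).re = 0 := fun q hq =>
    G.starProjection_inner_eq_zero (WithLp.toLp 2 (v, 0)) q hq
  refine ⟨p.fst, p.snd, hpG, fun a => ?_⟩
  have h1 : ∀ a : M, (⟪v - p.fst, ket ψ a⟫_ℂ).re = (⟪p.snd, ket ψ (star a)⟫_ℂ).re := by
    intro a
    have h : (⟪v - p.fst, ket ψ a⟫_ℂ + ⟪(0 : ψ.GNS) - p.snd, ket ψ (star a)⟫_ℂ).re = 0 :=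
      horth (WithLp.toLp 2 (ket ψ a, ket ψ (star a))) (subset_closure ⟨a, rfl⟩)
    rw [Complex.add_re, zero_sub, inner_neg_left, Complex.neg_re] at h
    linarith
  have h2 := h1 (Complex.I • a)
  have h3 := h1 a
  simp only [star_smul, ket_smul, inner_smul_right] at h2
  change ⟪p.snd, ket ψ (star a)⟫_ℂ = ⟪ket ψ a, v - p.fst⟫_ℂ
  rw [← inner_conj_symm (ket ψ a)]
  apply Complex.ext
  · rw [Complex.conj_re]
    exact h3.symm
  · rw [Complex.conj_im]
    simp at h2
    linarith

/-- Existence of the resolvent `(1 + Δ)⁻¹` as a bounded operator on the GNS space. -/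
theorem exists_resolvent : ∃ T : ψ.GNS →L[ℂ] ψ.GNS, ∀ v, (T v, v - T v) ∈ modularGraph ψ := by
  choose f hf using exists_mem_modularGraph ψ
  have huniq : ∀ v u, (u, v - u) ∈ modularGraph ψ → u = f v := by
    intro v u hu
    have h1 := modularGraph_add ψ hu (modularGraph_smul ψ (-1) (hf v))
    have h2 : (u - f v, (0 : ψ.GNS) - (u - f v)) ∈ modularGraph ψ := by
      convert h1 using 1
      ext <;> (simp; try abel)
    have := norm_le_of_mem_modularGraph ψ h2
    simpa [sub_eq_zero] using this
  let L : ψ.GNS →ₗ[ℂ] ψ.GNS :=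
    { toFun := f
      map_add' := fun x y => by
        refine (huniq _ _ ?_).symm
        convert modularGraph_add ψ (hf x) (hf y) using 1
        ext <;> (simp; try abel)
      map_smul' := fun c x => by
        refine (huniq _ _ ?_).symm
        convert modularGraph_smul ψ c (hf x) using 1
        ext <;> simp [smul_sub] }
  exact ⟨L.mkContinuous 1 fun v => by
    rw [one_mul]
    exact norm_le_of_mem_modularGraph ψ (hf v), hf⟩

/-- The bounded operator `(1 + Δ)⁻¹` on the GNS space. -/
def modularResolvent : ψ.GNS →L[ℂ] ψ.GNS := (exists_resolvent ψ).choose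

lemma modularResolvent_spec (v : ψ.GNS) :
    (modularResolvent ψ v, v - modularResolvent ψ v) ∈ modularGraph ψ :=
  (exists_resolvent ψ).choose_spec v

/-- The spectral measure `⟨v, dP(ω) v⟩` of the modular Hamiltonian `K = -log Δ` at `v`. Since
`x = 1 / (1 + λ)` means `-log λ = log (x / (1 - x))`, it is the image of the spectral measure of
`(1 + Δ)⁻¹`, which lives on `(0, 1)`, under `x ↦ log (x / (1 - x))`. -/
def modularSpectralMeasure (v : ψ.GNS) : Measure ℝ :=
  (spectralMeasure (modularResolvent ψ) v).map fun x => Real.log (x / (1 - x))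

/-- `v` lies in the domain of `Δ^{1/4}`: the number `⟨v, Δ^{1/2} v⟩ = ∫ e^{-ω/2} ⟨v, dP(ω) v⟩` is
finite. -/
def FiniteModularNorm (v : ψ.GNS) : Prop :=
  Integrable (fun ω : ℝ => Real.exp (-ω / 2)) (modularSpectralMeasure ψ v)

/-- `⟨ξ, Δ^{1/2 + it} η⟩ = ∫ e^{-(1/2 + it) ω} ⟨ξ, dP(ω) η⟩`, for `ξ`, `η` in the domain of
`Δ^{1/4}`. The complex measure `⟨ξ, dP η⟩` is
`4⁻¹ ∑ₖ (-i)^k ⟨ξ + i^k η, dP (ξ + i^k η)⟩`. -/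
def modularForm (ξ η : ψ.GNS) (t : ℝ) : ℂ :=
  4⁻¹ * ∑ k ∈ Finset.range 4, (-Complex.I) ^ k *
    ∫ ω : ℝ, Complex.exp (-(1 / 2 + Complex.I * t) * ω)
      ∂(modularSpectralMeasure ψ (ξ + Complex.I ^ k • η))

/-- The modular two-point function `f_{ab}(t) = ⟨1| a† Δ^{1/2 + it} b |1⟩` of `a, b` in the
algebra. -/
def modularCorrelator (a b : M) (t : ℝ) : ℂ := modularForm ψ (ket ψ a) (ket ψ b) t

/-- The one-point subtracted operator `a - ψ(a)`. -/
def subtracted (a : M) : M := a - algebraMap ℂ M (ψ a)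

/-! ### Operator systems and mixing -/

/-- The subspace `{x'|1⟩ : x' ∈ π(M)'}`, which is dense in the GNS space. -/
def commutantDomain : Submodule ℂ ψ.GNS where
  carrier := {v | ∃ x ∈ Set.centralizer (Set.range ψ.gnsStarAlgHom), x (vacuum ψ) = v}
  add_mem' := by
    rintro _ _ ⟨x, hx, rfl⟩ ⟨y, hy, rfl⟩
    exact ⟨x + y, Set.add_mem_centralizer hx hy, by simp⟩
  zero_mem' := ⟨0, Set.zero_mem_centralizer, by simp⟩
  smul_mem' := by
    rintro c _ ⟨x, hx, rfl⟩
    refine ⟨c • x, ?_, by simp⟩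
    intro m hm
    rw [mul_smul_comm, hx m hm, smul_mul_assoc]

lemma vacuum_mem_commutantDomain : vacuum ψ ∈ commutantDomain ψ :=
  ⟨1, Set.one_mem_centralizer, by simp⟩

/-- Possibly unbounded operators on the GNS space that are defined on the vectors `x'|1⟩` with `x'`
in the commutant, in particular on the vacuum. Bounded operators are those with full domain. -/
structure VacuumOperator where
  toLinearPMap : ψ.GNS →ₗ.[ℂ] ψ.GNS
  commutantDomain_le : commutantDomain ψ ≤ toLinearPMap.domain

variable {ψ}

/-- The vector `a|1⟩`. -/
def VacuumOperator.ket (a : VacuumOperator ψ) : ψ.GNS :=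
  a.toLinearPMap ⟨vacuum ψ, a.commutantDomain_le (vacuum_mem_commutantDomain ψ)⟩

/-- The operator system generated by the observables `O 0, O 1, …`: all operators
`a = α₀ + ∑ᵢ αᵢ Oᵢ` with complex coefficients and `f_{aa}(0) < ∞`. The series is only asked to
converge weakly on the domain of `a`. A finite family is covered by `O i = 0` for large `i`. -/
def operatorSystem (ψ : M →ₚ[ℂ] ℂ) (O : ℕ → M) : Set (VacuumOperator ψ) :=
  {a | (∃ (α₀ : ℂ) (α : ℕ → ℂ), ∀ (v : a.toLinearPMap.domain) (w : ψ.GNS),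
      Tendsto (fun n : ℕ => ⟪w, α₀ • (v : ψ.GNS) +
          ∑ i ∈ Finset.range n, α i • ψ.gnsStarAlgHom (O i) (v : ψ.GNS)⟫_ℂ)
        atTop (𝓝 ⟪w, a.toLinearPMap v⟫_ℂ)) ∧
    FiniteModularNorm ψ a.ket}

/-- The connected modular two-point function
`f_{ab}(t) - ⟨1| a† |1⟩ ⟨1| b |1⟩` of possibly unbounded operators. -/
def connectedCorrelator (a b : VacuumOperator ψ) (t : ℝ) : ℂ :=
  modularForm ψ a.ket b.ket t - ⟪a.ket, vacuum ψ⟫_ℂ * ⟪vacuum ψ, b.ket⟫_ℂ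

/-- A set of operators is `ψ`-mixing if the connected modular correlators of all pairs tend to zero
both in the future and in the past. -/
def IsMixing (S : Set (VacuumOperator ψ)) : Prop :=
  ∀ a ∈ S, ∀ b ∈ S, Tendsto (connectedCorrelator a b) atTop (𝓝 0) ∧
    Tendsto (connectedCorrelator a b) atBot (𝓝 0)

end Modular

/-- The Fourier transform of `f`, as a distribution `φ ↦ ∫ f 𝓕φ`, is a Lebesgue measurable function
`g` of the frequency: `φ ↦ ∫ g φ` on all test functions `φ`, these integrals being absolutely
convergent. -/
def HasMeasurableFourierTransform (f : ℝ → ℂ) : Prop :=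
  ∃ g : ℝ → ℂ, AEMeasurable g ∧ ∀ φ : 𝓢(ℝ, ℂ), HasCompactSupport φ →
    Integrable (fun ω => g ω * φ ω) ∧ ∫ t, f t * 𝓕 φ t = ∫ ω, g ω * φ ω

end

/-!
Vectors of the GNS space are compared through the positive finite measures
`μ_v = ⟨v, dP(ω) v⟩`, where `P` is the spectral resolution of `K = -log Δ`; complex measures
`⟨v, dP(ω) w⟩` enter only through polarization.

The vector `e_i = |O_i - ψ(O_i)⟩` lies in the domain of `Δ^{1/2}` (`finiteModularNorm_ket`), so its
modular autocorrelation is the Fourier–Stieltjes transform of the finite measure `e^{-ω/2} dμ_{e_i}`.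
By Fourier inversion, a measurable Fourier transform `g` means that this measure agrees with `g dω`
on test functions, which forces `μ_{e_i}` to be absolutely continuous
(`mem_modularACSubspace_of_hasMeasurableFourierTransform`).

The vectors with absolutely continuous measure form a closed subspace, by the parallelogram law for
`v ↦ μ_v` and `μ_v(ℝ) = ‖v‖²` (`isClosed_modularACSubspace`). A closed subspace is weakly closed, so
for an operator `a` in the operator system, `a|1⟩` is a multiple of the vacuum plus an absolutely
continuous vector orthogonal to the vacuum (`vacuumComplement_ket_mem_modularACSubspace`).

The vacuum is an eigenvector of `K` with eigenvalue zero. It contributes to the correlator the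
constant `⟨a 1|1⟩⟨1|b 1⟩`, and the remainder tends to zero by the Riemann–Lebesgue lemma
(`tendsto_modularForm_smul_vacuum_add`).

All of this is done with the bounded resolvent `T = (1 + Δ)⁻¹` instead of `Δ`. That `|a⟩` is in the
domain of `Δ^{1/2}` then follows from the bound
`|⟨a|(1 - T) z⟩|² ≤ ‖a⋆|1⟩‖² ⟨T z, (1 - T) z⟩`, a form of Cauchy–Schwarz for the Tomita operator,
applied to the regularizations `z = (T + ε)⁻¹|a⟩` of `T⁻¹|a⟩`
(`norm_inner_ket_sub_modularResolvent_sq_le`, `integral_regularized_le`).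
-/

noncomputable section

/-! ### Properties of the spectral measure -/

section SpectralMeasureBasic

variable {H : Type*} [NormedAddCommGroup H] [InnerProductSpace ℂ H] [CompleteSpace H]

instance (T : H →L[ℂ] H) (v : H) : (spectralMeasure T v).Regular := by
  unfold spectralMeasure; infer_instance

lemma spectralMeasure_compl_spectrum (T : H →L[ℂ] H) (v : H) :
    spectralMeasure T v (spectrum ℝ T)ᶜ = 0 := by
  have hK : IsClosed (spectrum ℝ T) := spectrum.isClosed T
  rw [hK.isOpen_compl.measure_eq_iSup_isCompact]
  simp only [ENNReal.iSup_eq_zero]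
  intro C hC hcomp
  obtain ⟨f, hf1, hf0, hfc, hf⟩ := exists_continuous_one_zero_of_isCompact hcomp hK
    (Set.disjoint_left.2 fun x hx => hC hx)
  have h := RealRMK.rieszMeasure_le_of_eq_one (spectralFunctional T v) (f := ⟨f, hfc⟩)
    (fun x => (hf x).1) hcomp (fun x hx => hf1 hx)
  have h0 : spectralFunctional T v ⟨f, hfc⟩ = 0 := by
    change (⟪v, (cfc (fun x => f x) T) v⟫_ℂ).re = 0
    have : cfc (fun x => f x) T = cfc (fun _ : ℝ => (0 : ℝ)) T :=
      cfc_congr fun x hx => hf0 hx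
    rw [this]
    simp [cfc_const_zero]
  rw [h0] at h
  simpa [spectralMeasure] using h

instance (T : H →L[ℂ] H) (v : H) : IsFiniteMeasure (spectralMeasure T v) := by
  refine ⟨?_⟩
  have hK : IsCompact (spectrum ℝ T) := spectrum.isCompact T
  rw [← Set.union_compl_self (spectrum ℝ T)]
  refine (measure_union_le _ _).trans_lt ?_
  rw [spectralMeasure_compl_spectrum, add_zero]
  exact hK.measure_lt_top

lemma ae_mem_spectrum (T : H →L[ℂ] H) (v : H) :
    ∀ᵐ x ∂(spectralMeasure T v), x ∈ spectrum ℝ T :=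
  spectralMeasure_compl_spectrum T v

/-- A continuous function on the line can be integrated against a spectral measure, although it need
not have compact support. -/
lemma integrable_spectralMeasure (T : H →L[ℂ] H) (v : H) {f : ℝ → ℝ} (hf : Continuous f) :
    Integrable f (spectralMeasure T v) := by
  have hK : IsCompact (spectrum ℝ T) := spectrum.isCompact T
  have h := hf.continuousOn.integrableOn_compact (μ := spectralMeasure T v) hK
  rwa [IntegrableOn, Measure.restrict_eq_self_of_ae_mem (ae_mem_spectrum T v)] at h

lemma integral_spectralMeasure (T : H →L[ℂ] H) (v : H) {f : ℝ → ℝ} (hf : Continuous f) :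
    ∫ x, f x ∂(spectralMeasure T v) = (⟪v, cfc f T v⟫_ℂ).re := by
  have hK : IsCompact (spectrum ℝ T) := spectrum.isCompact T
  obtain ⟨χ, hχ1, -, hχc, -⟩ := exists_continuous_one_zero_of_isCompact hK isClosed_empty
    (Set.disjoint_empty _)
  let g : C_c(ℝ, ℝ) := ⟨⟨fun x => f x * χ x, hf.mul χ.continuous⟩, hχc.mul_left⟩
  have hg : ∀ x ∈ spectrum ℝ T, f x = g x := by
    intro x hx
    have : χ x = 1 := hχ1 hx
    change f x = f x * χ x
    rw [this, mul_one]
  rw [cfc_congr hg, integral_congr_ae ((ae_mem_spectrum T v).mono hg)]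
  exact RealRMK.integral_rieszMeasure (spectralFunctional T v) g

lemma spectralMeasure_univ {T : H →L[ℂ] H} (hT : IsSelfAdjoint T) (v : H) :
    (spectralMeasure T v).real Set.univ = ‖v‖ ^ 2 := by
  have h := integral_spectralMeasure T v (f := fun _ => 1) continuous_const
  rw [cfc_const_one ℝ T] at h
  simp only [integral_const, smul_eq_mul, mul_one, one_apply_eq_self] at h
  rw [h]
  exact inner_self_eq_norm_sq (𝕜 := ℂ) v

/-- The parallelogram law for the quadratic map `v ↦ ⟨v, dE_T v⟩`. -/
lemma spectralMeasure_parallelogram (T : H →L[ℂ] H) (v w : H) :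
    spectralMeasure T (v + w) + spectralMeasure T (v - w) =
      (2 : ENNReal) • spectralMeasure T v + (2 : ENNReal) • spectralMeasure T w := by
  have : IsFiniteMeasure ((2 : ENNReal) • spectralMeasure T v) :=
    Measure.smul_finite _ (by simp)
  have : IsFiniteMeasure ((2 : ENNReal) • spectralMeasure T w) :=
    Measure.smul_finite _ (by simp)
  refine Measure.ext_of_integral_eq_on_compactlySupported fun f => ?_
  have hf : Continuous (f : ℝ → ℝ) := map_continuous f
  have hi := fun u => integrable_spectralMeasure T u hf
  rw [integral_add_measure (hi _) (hi _), integral_add_measure ((hi _).smul_measure (by simp))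
    ((hi _).smul_measure (by simp)), integral_smul_measure, integral_smul_measure]
  simp only [integral_spectralMeasure T _ hf]
  simp
  ring

lemma spectralMeasure_smul (T : H →L[ℂ] H) (c : ℂ) (v : H) :
    spectralMeasure T (c • v) = ENNReal.ofReal (‖c‖ ^ 2) • spectralMeasure T v := by
  have : IsFiniteMeasure (ENNReal.ofReal (‖c‖ ^ 2) • spectralMeasure T v) :=
    Measure.smul_finite _ (by simp)
  refine Measure.ext_of_integral_eq_on_compactlySupported fun f => ?_
  have hf : Continuous (f : ℝ → ℝ) := map_continuous f
  rw [integral_smul_measure]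
  simp only [integral_spectralMeasure T _ hf]
  rw [map_smul, inner_smul_left, inner_smul_right, ← mul_assoc, ← Complex.normSq_eq_conj_mul_self,
    Complex.re_ofReal_mul, Complex.normSq_eq_norm_sq, ENNReal.toReal_ofReal (by positivity),
    smul_eq_mul]

lemma norm_sq_cfc_apply {T : H →L[ℂ] H} (hT : IsSelfAdjoint T) {f : ℝ → ℝ} (hf : Continuous f) (v : H) :
    ‖cfc f T v‖ ^ 2 = ∫ x, f x ^ 2 ∂(spectralMeasure T v) := by
  have hsa : IsSelfAdjoint (cfc f T) := cfc_predicate f T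
  rw [integral_spectralMeasure T v (f := fun x => f x ^ 2) (by fun_prop),
    cfc_pow f 2 T hf.continuousOn, pow_two (cfc f T), mul_apply_eq_comp,
    ← ContinuousLinearMap.adjoint_inner_left, hsa.adjoint_eq]
  exact (inner_self_eq_norm_sq (𝕜 := ℂ) _).symm

/-- The continuous functional calculus acts on an eigenvector through the eigenvalue. -/
lemma cfc_apply_eigenvector {T : H →L[ℂ] H} (hT : IsSelfAdjoint T) {v : H} {r : ℝ}
    (hv : T v = (r : ℂ) • v) {f : ℝ → ℝ} (hf : Continuous f) :
    cfc f T v = (f r : ℂ) • v := by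
  have key : ∀ g : ℝ → ℝ, Continuous g → cfc (fun x => g x - g r) T v =
      cfc g T v - (g r : ℂ) • v := by
    intro g hg
    rw [cfc_sub g (fun _ => g r) T hg.continuousOn, cfc_const (g r) T,
      Algebra.algebraMap_eq_smul_one]
    simp
  -- the spectral measure is concentrated at the eigenvalue, since `(T - r) v = 0`
  have h0 : ∫ x, (x - r) ^ 2 ∂(spectralMeasure T v) = 0 := by
    rw [← norm_sq_cfc_apply hT (f := fun x => x - r) (by fun_prop), key (fun x => x) continuous_id,
      cfc_id' ℝ T, hv]
    simp
  rw [integral_eq_zero_iff_of_nonneg (fun x => sq_nonneg _)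
    (integrable_spectralMeasure T v (f := fun x => (x - r) ^ 2) (by fun_prop))] at h0
  have h1 : ∫ x, (f x - f r) ^ 2 ∂(spectralMeasure T v) = 0 := by
    refine integral_eq_zero_of_ae (h0.mono fun x hx => ?_)
    have hx' : x = r := by simpa [sub_eq_zero] using hx
    simp [hx']
  rw [← norm_sq_cfc_apply hT (f := fun x => f x - f r) (by fun_prop), key f hf] at h1
  simpa [sub_eq_zero] using h1

/-- An eigenvector splits off from an orthogonal vector as an atom of the spectral measure. -/
lemma spectralMeasure_smul_add_of_eigenvector {T : H →L[ℂ] H} (hT : IsSelfAdjoint T) {v w : H}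
    {r : ℝ} (hv : T v = (r : ℂ) • v) (hv1 : ‖v‖ = 1) (hw : ⟪v, w⟫_ℂ = 0) (c : ℂ) :
    spectralMeasure T (c • v + w) =
      ENNReal.ofReal (‖c‖ ^ 2) • Measure.dirac r + spectralMeasure T w := by
  have : IsFiniteMeasure (ENNReal.ofReal (‖c‖ ^ 2) • Measure.dirac r) :=
    Measure.smul_finite _ (by simp)
  refine Measure.ext_of_integral_eq_on_compactlySupported fun f => ?_
  have hf : Continuous (f : ℝ → ℝ) := map_continuous f
  have hfv := cfc_apply_eigenvector hT hv hf
  have hsa : IsSelfAdjoint (cfc (f : ℝ → ℝ) T) := cfc_predicate _ T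
  have hvw : ⟪v, cfc (f : ℝ → ℝ) T w⟫_ℂ = 0 := by
    rw [← ContinuousLinearMap.adjoint_inner_left, hsa.adjoint_eq, hfv, inner_smul_left, hw, mul_zero]
  have hwv : ⟪w, v⟫_ℂ = 0 := inner_eq_zero_symm.1 hw
  rw [integral_add_measure
    ((integrable_dirac (by simp)).smul_measure (by simp))
    (integrable_spectralMeasure T w hf), integral_smul_measure, integral_dirac]
  simp only [integral_spectralMeasure T _ hf]
  have h1 : ⟪v, v⟫_ℂ = 1 := by rw [inner_self_eq_norm_sq_to_K, hv1]; simp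
  rw [map_add, map_smul, hfv]
  simp only [inner_add_left, inner_add_right, inner_smul_left, inner_smul_right, hvw, hwv, h1]
  rw [ENNReal.toReal_ofReal (by positivity), ← Complex.normSq_eq_norm_sq]
  simp [Complex.normSq_apply]
  ring

end SpectralMeasureBasic

section Resolvent

variable {M : Type*} [CStarAlgebra M] [PartialOrder M] [StarOrderedRing M] (ψ : M →ₚ[ℂ] ℂ)

/-! ### The resolvent of the modular operator -/

/-- The defining relation of `S⋆ S` extends from the core to the whole graph of `S`. -/
lemma exists_adjoint_of_mem_modularGraph {p : ψ.GNS × ψ.GNS} (hp : p ∈ modularGraph ψ) :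
    ∃ w, (p.1, w) ∈ tomitaGraph ψ ∧ ∀ q ∈ tomitaGraph ψ, ⟪w, q.2⟫_ℂ = ⟪q.1, p.2⟫_ℂ := by
  obtain ⟨w, hw, h⟩ := hp
  refine ⟨w, hw, fun q hq => ?_⟩
  refine closure_minimal (t := {q : ψ.GNS × ψ.GNS | ⟪w, q.2⟫_ℂ = ⟪q.1, p.2⟫_ℂ}) ?_
    (isClosed_eq (by fun_prop) (by fun_prop)) hq
  rintro _ ⟨a, rfl⟩
  exact h a

/-- Symmetry of the modular operator. -/
lemma modularGraph_symm {p q : ψ.GNS × ψ.GNS} (hp : p ∈ modularGraph ψ)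
    (hq : q ∈ modularGraph ψ) : ⟪p.1, q.2⟫_ℂ = ⟪p.2, q.1⟫_ℂ := by
  obtain ⟨w, hw, h⟩ := exists_adjoint_of_mem_modularGraph ψ hp
  obtain ⟨w', hw', h'⟩ := exists_adjoint_of_mem_modularGraph ψ hq
  rw [← h' _ hw, ← inner_conj_symm, ← inner_conj_symm p.2, ← h _ hw']

lemma modularResolvent_isSelfAdjoint : IsSelfAdjoint (modularResolvent ψ) := by
  rw [ContinuousLinearMap.isSelfAdjoint_iff_isSymmetric]
  intro x y
  have h := modularGraph_symm ψ (modularResolvent_spec ψ x) (modularResolvent_spec ψ y)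
  simp only [inner_sub_left, inner_sub_right] at h
  simpa using h

lemma modularResolvent_eq_of_mem {u v : ψ.GNS} (h : (u, v - u) ∈ modularGraph ψ) :
    modularResolvent ψ v = u := by
  have h1 := modularGraph_add ψ (modularResolvent_spec ψ v) (modularGraph_smul ψ (-1) h)
  have h2 : (modularResolvent ψ v - u, (0 : ψ.GNS) - (modularResolvent ψ v - u)) ∈
      modularGraph ψ := by
    convert h1 using 1
    ext <;> (simp; try abel)
  simpa [sub_eq_zero] using norm_le_of_mem_modularGraph ψ h2

lemma modularResolvent_nonneg : 0 ≤ modularResolvent ψ := by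
  rw [ContinuousLinearMap.nonneg_iff_isPositive, ContinuousLinearMap.isPositive_def']
  refine ⟨modularResolvent_isSelfAdjoint ψ, fun v => ?_⟩
  rw [ContinuousLinearMap.reApplyInnerSelf_apply]
  have h1 := modularGraph_pos ψ (modularResolvent_spec ψ v)
  have h2 := inner_self_nonneg (𝕜 := ℂ) (x := modularResolvent ψ v)
  simp only [inner_sub_right, Complex.sub_re, RCLike.re_to_complex] at h1 h2 ⊢
  linarith

lemma modularResolvent_le_one : modularResolvent ψ ≤ 1 := by
  rw [ContinuousLinearMap.le_def, ContinuousLinearMap.isPositive_def']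
  refine ⟨(IsSelfAdjoint.one _).sub (modularResolvent_isSelfAdjoint ψ), fun v => ?_⟩
  rw [ContinuousLinearMap.reApplyInnerSelf_apply]
  have h1 := modularGraph_pos ψ (modularResolvent_spec ψ v)
  have h2 := inner_self_nonneg (𝕜 := ℂ) (x := v - modularResolvent ψ v)
  have h3 := inner_re_symm (𝕜 := ℂ) (modularResolvent ψ v) v
  simp only [inner_sub_right, inner_sub_left, Complex.sub_re, RCLike.re_to_complex,
    sub_apply, one_apply_eq_self] at h1 h2 h3 ⊢
  linarith

lemma spectrum_modularResolvent : spectrum ℝ (modularResolvent ψ) ⊆ Set.Icc 0 1 := by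
  intro x hx
  refine ⟨spectrum_nonneg_of_nonneg (modularResolvent_nonneg ψ) hx, ?_⟩
  refine (le_algebraMap_iff_spectrum_le (R := ℝ) (modularResolvent_isSelfAdjoint ψ)).1 ?_ x hx
  simpa using modularResolvent_le_one ψ

lemma ae_mem_Icc (v : ψ.GNS) :
    ∀ᵐ x ∂(spectralMeasure (modularResolvent ψ) v), x ∈ Set.Icc (0 : ℝ) 1 :=
  (ae_mem_spectrum _ v).mono fun _ hx => spectrum_modularResolvent ψ hx

/-- The form bound expressing that `|a⟩` is in the domain of `Δ^{1/2}`: formally,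
`⟨a|(1 - T) z⟩ = ⟨a|Δ T z⟩ = ⟨S T z, S a⟩` and `‖S T z‖² = ⟨T z, Δ T z⟩`, with `T = (1 + Δ)⁻¹`. -/
lemma norm_inner_ket_sub_modularResolvent_sq_le (a : M) (z : ψ.GNS) :
    ‖⟪ket ψ a, z - modularResolvent ψ z⟫_ℂ‖ ^ 2 ≤
      ‖ket ψ (star a)‖ ^ 2 * (⟪modularResolvent ψ z, z - modularResolvent ψ z⟫_ℂ).re := by
  obtain ⟨w, hw, h⟩ := exists_adjoint_of_mem_modularGraph ψ (modularResolvent_spec ψ z)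
  have h1 := h _ hw
  have h2 := h (ket ψ a, ket ψ (star a)) (subset_closure ⟨a, rfl⟩)
  simp only at h1 h2
  have h3 : (⟪w, w⟫_ℂ).re = ‖w‖ ^ 2 := inner_self_eq_norm_sq (𝕜 := ℂ) w
  rw [← h1, ← h2, h3, ← mul_pow, mul_comm]
  gcongr
  exact norm_inner_le_norm _ _

/-! ### The vacuum -/

lemma inner_ket (a b : M) : ⟪ket ψ a, ket ψ b⟫_ℂ = ψ (star a * b) := by
  rw [ket, ket, UniformSpace.Completion.inner_coe, PositiveLinearMap.preGNS_inner_def]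
  simp

lemma gnsStarAlgHom_vacuum (a : M) : ψ.gnsStarAlgHom a (vacuum ψ) = ket ψ a := by
  change ψ.gnsNonUnitalStarAlgHom a (ψ.toPreGNS 1 : ψ.PreGNS) = ket ψ a
  rw [PositiveLinearMap.gnsNonUnitalStarAlgHom_apply_coe, PositiveLinearMap.leftMulMapPreGNS_apply]
  simp [ket]

lemma modularResolvent_vacuum :
    modularResolvent ψ (vacuum ψ) = ((1 / 2 : ℝ) : ℂ) • vacuum ψ := by
  have h : (vacuum ψ, vacuum ψ) ∈ modularGraph ψ := by
    refine ⟨vacuum ψ, subset_closure ⟨1, by simp [vacuum]⟩, fun a => ?_⟩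
    simp [vacuum, inner_ket]
  refine modularResolvent_eq_of_mem ψ ?_
  convert modularGraph_smul ψ ((1 / 2 : ℝ) : ℂ) h using 1
  ext
  · rfl
  · simp only [Prod.smul_mk]
    rw [sub_eq_iff_eq_add, ← add_smul]
    norm_num

variable {ψ} in
lemma norm_vacuum (h1 : ψ 1 = 1) : ‖vacuum ψ‖ = 1 := by
  have h : ‖ket ψ 1‖ ^ 2 = 1 := by
    rw [← inner_self_eq_norm_sq (𝕜 := ℂ), inner_ket]
    simp [h1]
  rw [vacuum]
  nlinarith [norm_nonneg (ket ψ 1)]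

/-! ### Spectral measures of the modular Hamiltonian -/

lemma measurable_log_div : Measurable fun x : ℝ => Real.log (x / (1 - x)) := by fun_prop

instance (v : ψ.GNS) : IsFiniteMeasure (modularSpectralMeasure ψ v) := by
  unfold modularSpectralMeasure; infer_instance

lemma modularSpectralMeasure_univ (v : ψ.GNS) :
    modularSpectralMeasure ψ v Set.univ = ENNReal.ofReal (‖v‖ ^ 2) := by
  rw [modularSpectralMeasure, Measure.map_apply measurable_log_div MeasurableSet.univ,
    Set.preimage_univ, ← spectralMeasure_univ (modularResolvent_isSelfAdjoint ψ) v,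
    ofReal_measureReal]

lemma modularSpectralMeasure_parallelogram (v w : ψ.GNS) :
    modularSpectralMeasure ψ (v + w) + modularSpectralMeasure ψ (v - w) =
      (2 : ENNReal) • modularSpectralMeasure ψ v + (2 : ENNReal) • modularSpectralMeasure ψ w := by
  simp only [modularSpectralMeasure]
  rw [← Measure.map_add _ _ measurable_log_div, spectralMeasure_parallelogram,
    Measure.map_add _ _ measurable_log_div, Measure.map_smul, Measure.map_smul]

lemma modularSpectralMeasure_add_le (v w : ψ.GNS) :
    modularSpectralMeasure ψ (v + w) ≤
      (2 : ENNReal) • modularSpectralMeasure ψ v + (2 : ENNReal) • modularSpectralMeasure ψ w := by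
  rw [← modularSpectralMeasure_parallelogram]
  exact Measure.le_add_right le_rfl

lemma modularSpectralMeasure_smul (c : ℂ) (v : ψ.GNS) :
    modularSpectralMeasure ψ (c • v) = ENNReal.ofReal (‖c‖ ^ 2) • modularSpectralMeasure ψ v := by
  simp only [modularSpectralMeasure]
  rw [spectralMeasure_smul, Measure.map_smul]

variable {ψ} in
/-- The vacuum component of a vector contributes an atom at frequency zero. -/
lemma modularSpectralMeasure_smul_vacuum_add (h1 : ψ 1 = 1) (c : ℂ) {w : ψ.GNS}
    (hw : ⟪vacuum ψ, w⟫_ℂ = 0) :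
    modularSpectralMeasure ψ (c • vacuum ψ + w) =
      ENNReal.ofReal (‖c‖ ^ 2) • Measure.dirac 0 + modularSpectralMeasure ψ w := by
  simp only [modularSpectralMeasure]
  rw [spectralMeasure_smul_add_of_eigenvector (modularResolvent_isSelfAdjoint ψ)
    (modularResolvent_vacuum ψ) (norm_vacuum h1) hw, Measure.map_add _ _ measurable_log_div,
    Measure.map_smul, Measure.map_dirac' measurable_log_div]
  norm_num

/-! ### Vectors of the algebra have finite modular norm -/

/-- Regularized form of `⟨a|Δ|a⟩ ≤ ‖S a‖²`, as an integral over the spectrum of `(1 + Δ)⁻¹`. -/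
lemma integral_regularized_le (a : M) {ε : ℝ} (hε : 0 < ε) :
    ∫ x, (1 - x) * (max x 0 + ε)⁻¹ ∂(spectralMeasure (modularResolvent ψ) (ket ψ a)) ≤
      ‖ket ψ (star a)‖ ^ 2 := by
  set T := modularResolvent ψ with hT
  set v := ket ψ a with hv
  have hsa : IsSelfAdjoint T := modularResolvent_isSelfAdjoint ψ
  let h : ℝ → ℝ := fun x => (max x 0 + ε)⁻¹
  have hpos : ∀ x, 0 < max x 0 + ε := fun x => by positivity
  have hh : Continuous h := Continuous.inv₀ (by fun_prop) fun x => (hpos x).ne'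
  have hh0 : ∀ x, 0 ≤ h x := fun x => (inv_pos.2 (hpos x)).le
  set z := cfc h T v with hz
  have hid : cfc (fun x : ℝ => x) T = T := cfc_id' ℝ T
  have h1 : z - T z = cfc (fun x => (1 - x) * h x) T v := by
    rw [cfc_mul (fun x => 1 - x) h T (by fun_prop) hh.continuousOn,
      cfc_sub (fun _ => 1) (fun x => x) T (by fun_prop) (by fun_prop), hid, cfc_const_one ℝ T]
    simp [hz]
  have hA : (⟪v, z - T z⟫_ℂ).re = ∫ x, (1 - x) * h x ∂(spectralMeasure T v) := by
    rw [h1, integral_spectralMeasure T v (f := fun x => (1 - x) * h x) (by fun_prop)]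
  have h2 : T z = cfc (fun x => x * h x) T v := by
    rw [cfc_mul (fun x => x) h T (by fun_prop) hh.continuousOn, hid]
    simp [hz]
  have hB : (⟪T z, z - T z⟫_ℂ).re =
      ∫ x, (x * h x) * ((1 - x) * h x) ∂(spectralMeasure T v) := by
    have hsa' : IsSelfAdjoint (cfc (fun x => x * h x) T) := cfc_predicate _ T
    rw [integral_spectralMeasure T v (f := fun x => (x * h x) * ((1 - x) * h x)) (by fun_prop),
      cfc_mul (fun x => x * h x) (fun x => (1 - x) * h x) T (by fun_prop) (by fun_prop),
      mul_apply_eq_comp, ← h1, ← ContinuousLinearMap.adjoint_inner_left, hsa'.adjoint_eq, ← h2]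
  have hBA : (⟪T z, z - T z⟫_ℂ).re ≤ (⟪v, z - T z⟫_ℂ).re := by
    rw [hA, hB]
    refine integral_mono_ae (integrable_spectralMeasure T v (by fun_prop))
      (integrable_spectralMeasure T v (by fun_prop)) ((ae_mem_Icc ψ v).mono fun x hx => ?_)
    have hx1 : x * h x ≤ 1 := by
      change x * (max x 0 + ε)⁻¹ ≤ 1
      rw [← div_eq_mul_inv, div_le_one (hpos x), max_eq_left hx.1]
      linarith
    have hx2 : 0 ≤ (1 - x) * h x := mul_nonneg (by linarith [hx.2]) (hh0 x)
    simpa using mul_le_mul_of_nonneg_right hx1 hx2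
  have hA0 : 0 ≤ (⟪v, z - T z⟫_ℂ).re := by
    rw [hA]
    exact integral_nonneg_of_ae ((ae_mem_Icc ψ v).mono fun x hx =>
      mul_nonneg (by linarith [hx.2]) (hh0 x))
  have hkey := norm_inner_ket_sub_modularResolvent_sq_le ψ a z
  have h3 : (⟪v, z - T z⟫_ℂ).re ≤ ‖⟪v, z - T z⟫_ℂ‖ := Complex.re_le_norm _
  change ∫ x, (1 - x) * h x ∂(spectralMeasure T v) ≤ _
  rw [← hA]
  rw [← hT, ← hv] at hkey
  -- with `A = ⟨v, (1 - T) z⟩` this reads `A² ≤ ‖S a‖² A`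
  rcases hA0.eq_or_lt with h0 | h0
  · rw [← h0]; positivity
  · nlinarith [sq_nonneg ‖ket ψ (star a)‖]

/-- `⟨a|Δ|a⟩` is finite, by Fatou's lemma applied to the regularized integrals. -/
lemma integrable_one_sub_div (a : M) :
    Integrable (fun x : ℝ => (1 - x) / x) (spectralMeasure (modularResolvent ψ) (ket ψ a)) := by
  set μ := spectralMeasure (modularResolvent ψ) (ket ψ a) with hμ
  have hmeas : Measurable fun x : ℝ => (1 - x) / x := by fun_prop
  let ε : ℕ → ℝ := fun n => 1 / ((n : ℝ) + 1)
  have hε : ∀ n, 0 < ε n := fun n => by positivity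
  let F : ℕ → ℝ → ℝ := fun n x => (1 - x) * (max x 0 + ε n)⁻¹
  have hFc : ∀ n, Continuous (F n) := fun n => by
    refine Continuous.mul (by fun_prop) (Continuous.inv₀ (by fun_prop) fun x => ?_)
    have := hε n
    positivity
  have hF0 : ∀ n, 0 ≤ᵐ[μ] F n := fun n => (ae_mem_Icc ψ _).mono fun x hx => by
    have := hε n
    exact mul_nonneg (by linarith [hx.2]) (by positivity)
  refine ⟨hmeas.aestronglyMeasurable, ?_⟩
  rw [hasFiniteIntegral_iff_ofReal ((ae_mem_Icc ψ _).mono fun x hx =>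
    div_nonneg (by linarith [hx.2]) hx.1)]
  calc ∫⁻ x, ENNReal.ofReal ((1 - x) / x) ∂μ
      ≤ ∫⁻ x, liminf (fun n => ENNReal.ofReal (F n x)) atTop ∂μ := by
        refine lintegral_mono_ae ((ae_mem_Icc ψ _).mono fun x hx => ?_)
        rcases hx.1.eq_or_lt with h0 | h0
        · rw [← h0]; simp
        · refine le_of_eq (Tendsto.liminf_eq ?_).symm
          refine ENNReal.tendsto_ofReal ?_
          have h1 : Tendsto (fun n => max x 0 + ε n) atTop (𝓝 (x + 0)) := by
            rw [max_eq_left hx.1]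
            exact tendsto_const_nhds.add tendsto_one_div_add_atTop_nhds_zero_nat
          rw [add_zero] at h1
          rw [div_eq_mul_inv]
          exact (h1.inv₀ h0.ne').const_mul _
    _ ≤ liminf (fun n => ∫⁻ x, ENNReal.ofReal (F n x) ∂μ) atTop :=
        lintegral_liminf_le fun n => (hFc n).measurable.ennreal_ofReal
    _ ≤ ENNReal.ofReal (‖ket ψ (star a)‖ ^ 2) := by
        refine liminf_le_of_le (by isBoundedDefault) fun b hb => ?_
        obtain ⟨n, hn⟩ := hb.exists
        refine hn.trans ?_
        rw [← ofReal_integral_eq_lintegral_ofReal (integrable_spectralMeasure _ _ (hFc n)) (hF0 n)]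
        exact ENNReal.ofReal_le_ofReal (integral_regularized_le ψ a (hε n))
    _ < ⊤ := ENNReal.ofReal_lt_top

/-- Vectors `|a⟩` with `a` in the algebra are in the domain of `Δ^{1/2}`, hence of `Δ^{1/4}`. -/
lemma finiteModularNorm_ket (a : M) : FiniteModularNorm ψ (ket ψ a) := by
  unfold FiniteModularNorm modularSpectralMeasure
  rw [integrable_map_measure (by fun_prop) measurable_log_div.aemeasurable]
  refine Integrable.mono' ((integrable_const (1 : ℝ)).add (integrable_one_sub_div ψ a))
    (Measurable.aestronglyMeasurable (by fun_prop)) ((ae_mem_Icc ψ _).mono fun x hx => ?_)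
  simp only [Function.comp_apply, Pi.add_apply, Real.norm_eq_abs, Real.abs_exp]
  have h0 : 0 ≤ (1 - x) / x := div_nonneg (by linarith [hx.2]) hx.1
  -- at `x = 0` and `x = 1` the frequency `log (x / (1 - x))` has the junk value `0`
  rcases hx.1.eq_or_lt with h | h
  · rw [← h]; simp
  rcases hx.2.eq_or_lt with h' | h'
  · rw [h']; simp
  have hy : 0 < (1 - x) / x := div_pos (by linarith) h
  have h2 : -Real.log (x / (1 - x)) = Real.log ((1 - x) / x) := by rw [← Real.log_inv, inv_div]
  have h3 : Real.exp (Real.log ((1 - x) / x) / 2) ^ 2 = (1 - x) / x := by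
    rw [← Real.exp_nat_mul]
    push_cast
    rw [mul_div_cancel₀ _ two_ne_zero, Real.exp_log hy]
  rw [h2]
  nlinarith [sq_nonneg (Real.exp (Real.log ((1 - x) / x) / 2) - 1)]

end Resolvent

section Fourier

/-! ### Absolute continuity from the Fourier transform -/

/-- Smooth Urysohn function as a Schwartz function: one on a compact set, with values in `[0, 1]`,
and zero outside a prescribed neighbourhood. -/
lemma exists_schwartz_eq_one_of_isCompact {K : Set ℝ} (hK : IsCompact K) {δ : ℝ} (hδ : 0 < δ) :
    ∃ (φ : 𝓢(ℝ, ℂ)) (r : ℝ → ℝ), HasCompactSupport φ ∧ (∀ x, φ x = r x) ∧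
      (∀ x, r x ∈ Set.Icc (0 : ℝ) 1) ∧ (∀ x ∈ K, r x = 1) ∧
      ∀ x ∉ Metric.thickening δ K, r x = 0 := by
  obtain ⟨r, hr, hr01, hrs, hr1⟩ := exists_contMDiff_support_eq_eq_one_iff
    (modelWithCornersSelf ℝ ℝ) (Metric.isOpen_thickening (δ := δ) (E := K)) hK.isClosed
    (Metric.self_subset_thickening hδ K)
  have hrc : HasCompactSupport fun x => (r x : ℂ) := by
    refine HasCompactSupport.intro (hK.cthickening (r := δ)) fun x hx => ?_
    have : x ∉ Function.support r := by
      rw [hrs]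
      exact fun h => hx (Metric.thickening_subset_cthickening _ _ h)
    simpa using this
  have hrd : ContDiff ℝ (⊤ : ℕ∞) fun x => (r x : ℂ) :=
    Complex.ofRealCLM.contDiff.comp (contMDiff_iff_contDiff.1 hr)
  refine ⟨hrc.toSchwartzMap hrd, r, hrc, fun x => rfl, fun x => hr01 ⟨x, rfl⟩,
    fun x hx => (hr1 x).1 hx, fun x hx => ?_⟩
  rw [← hrs] at hx
  simpa using hx

/-- A finite measure that acts on compactly supported test functions as integration against a locally
integrable complex function is absolutely continuous. No sign or reality of `g` is assumed. -/
lemma absolutelyContinuous_of_forall_integral_schwartz {ν : Measure ℝ} [IsFiniteMeasure ν]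
    {g : ℝ → ℂ}
    (hg : ∀ φ : 𝓢(ℝ, ℂ), HasCompactSupport φ →
      Integrable (fun x => g x * φ x) ∧ ∫ x, φ x ∂ν = ∫ x, g x * φ x) :
    ν ≪ volume := by
  refine Measure.AbsolutelyContinuous.mk fun s hs hs0 => ?_
  rw [hs.measure_eq_iSup_isCompact]
  simp only [ENNReal.iSup_eq_zero]
  intro K hKs hK
  have hK0 : volume K = 0 := measure_mono_null hKs hs0
  have hδ : ∀ n : ℕ, 0 < 1 / ((n : ℝ) + 1) := fun n => by positivity
  choose φ r hφc hφr hr01 hr1 hr0 using fun n : ℕ =>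
    exists_schwartz_eq_one_of_isCompact hK (hδ n)
  obtain ⟨Φ, R, hΦc, hΦR, -, hR1, -⟩ :=
    exists_schwartz_eq_one_of_isCompact (hK.cthickening (r := 1)) one_pos
  -- the test functions shrink to the indicator function of a null set
  have hlim : Tendsto (fun n => ∫ x, g x * φ n x) atTop (𝓝 0) := by
    rw [← integral_zero ℝ ℂ]
    refine tendsto_integral_of_dominated_convergence (fun x => ‖g x * Φ x‖)
      (fun n => (hg _ (hφc n)).1.aestronglyMeasurable) (hg _ hΦc).1.norm (fun n => ?_) ?_
    · refine ae_of_all _ fun x => ?_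
      rw [norm_mul, norm_mul]
      refine mul_le_mul_of_nonneg_left ?_ (norm_nonneg _)
      by_cases hx : x ∈ Metric.cthickening 1 K
      · rw [hΦR, hR1 x hx, hφr, Complex.norm_real, Real.norm_of_nonneg (hr01 n x).1]
        simpa using (hr01 n x).2
      · have : x ∉ Metric.thickening (1 / ((n : ℝ) + 1)) K := fun h => hx
          (Metric.thickening_subset_cthickening_of_le (by
            rw [div_le_one (by positivity)]; linarith [n.cast_nonneg (α := ℝ)]) _ h)
        rw [hφr, hr0 n x this]
        simp
    · have hae : ∀ᵐ x : ℝ, x ∉ K := measure_eq_zero_iff_ae_notMem.1 hK0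
      filter_upwards [hae] with x hx
      refine tendsto_const_nhds.congr' ?_
      rcases K.eq_empty_or_nonempty with rfl | hne
      · refine Eventually.of_forall fun n => ?_
        change 0 = g x * φ n x
        rw [hφr, hr0 n x (by simp)]
        simp
      have hpos : 0 < Metric.infDist x K := (hK.isClosed.notMem_iff_infDist_pos hne).1 hx
      filter_upwards [tendsto_one_div_add_atTop_nhds_zero_nat.eventually_lt_const hpos] with n hn
      change 0 = g x * φ n x
      rw [hφr, hr0 n x fun h => ?_]
      · simp
      · rw [Metric.mem_thickening_iff_infDist_lt hne] at h
        linarith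
  have hle : ∀ n, ν.real K ≤ ‖∫ x, g x * φ n x‖ := by
    intro n
    rw [← (hg _ (hφc n)).2, integral_congr_ae (ae_of_all _ (hφr n)), integral_complex_ofReal,
      Complex.norm_real]
    refine le_trans ?_ (le_abs_self _)
    rw [← integral_indicator_one hK.measurableSet]
    have hri : Integrable (r n) ν := by
      simpa [hφr] using ((φ n).integrable (μ := ν)).re
    refine integral_mono ((integrable_const (1 : ℝ)).indicator hK.measurableSet) hri fun x => ?_
    by_cases hx : x ∈ K
    · simp [hx, hr1 n x hx]
    · simpa [hx] using (hr01 n x).1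
  have h0 : ν.real K ≤ 0 := by
    have h := ge_of_tendsto' hlim.norm hle
    simpa using h
  exact (measureReal_eq_zero_iff).1 (le_antisymm h0 measureReal_nonneg)

/-- Fubini and Fourier inversion: as a distribution, the Fourier transform of the Fourier transform
of a finite measure is the reflected and rescaled measure. -/
lemma integral_charFun_mul_fourier (ν : Measure ℝ) [IsFiniteMeasure ν] (φ : 𝓢(ℝ, ℂ)) :
    ∫ t : ℝ, (∫ ω : ℝ, Complex.exp (-(Complex.I * t * ω)) ∂ν) * 𝓕 φ t =
      ∫ ω : ℝ, φ (-ω / (2 * Real.pi)) ∂ν := by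
  have hint : Integrable (Function.uncurry fun (t ω : ℝ) =>
      Complex.exp (-(Complex.I * t * ω)) * 𝓕 φ t) (volume.prod ν) := by
    have h1 : Integrable (fun p : ℝ × ℝ => 𝓕 φ p.1) (volume.prod ν) :=
      ((𝓕 φ).integrable (μ := volume)).comp_fst ν
    refine h1.bdd_mul (c := 1) (Continuous.aestronglyMeasurable (by fun_prop))
      (ae_of_all _ fun p => ?_)
    have : -(Complex.I * (p.1 : ℂ) * (p.2 : ℂ)) = ((-(p.1 * p.2) : ℝ) : ℂ) * Complex.I := by
      push_cast; ring
    rw [this, Complex.norm_exp_ofReal_mul_I]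
  calc ∫ t : ℝ, (∫ ω : ℝ, Complex.exp (-(Complex.I * t * ω)) ∂ν) * 𝓕 φ t
      = ∫ t : ℝ, ∫ ω : ℝ, Complex.exp (-(Complex.I * t * ω)) * 𝓕 φ t ∂ν := by
        simp only [integral_mul_const]
    _ = ∫ ω : ℝ, (∫ t : ℝ, Complex.exp (-(Complex.I * t * ω)) * 𝓕 φ t) ∂ν :=
        integral_integral_swap hint
    _ = ∫ ω : ℝ, φ (-ω / (2 * Real.pi)) ∂ν := by
        congr 1
        ext ω
        have h : 𝓕⁻ (𝓕 φ) (-ω / (2 * Real.pi)) = φ (-ω / (2 * Real.pi)) := by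
          simp
        rw [← h, SchwartzMap.fourierInv_coe, Real.fourierInv_eq']
        congr 1
        ext t
        rw [smul_eq_mul]
        congr 2
        simp only [RCLike.inner_apply, conj_trivial]
        push_cast
        field_simp

lemma absolutelyContinuous_of_hasMeasurableFourierTransform {ν : Measure ℝ} [IsFiniteMeasure ν]
    (h : HasMeasurableFourierTransform fun t =>
      ∫ ω : ℝ, Complex.exp (-(Complex.I * t * ω)) ∂ν) :
    ν ≪ volume := by
  obtain ⟨g, -, hg⟩ := h
  have hm : Measurable fun ω : ℝ => -ω / (2 * Real.pi) := by fun_prop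
  have hac : ν.map (fun ω : ℝ => -ω / (2 * Real.pi)) ≪ volume := by
    refine absolutelyContinuous_of_forall_integral_schwartz (g := g) fun φ hφ =>
      ⟨(hg φ hφ).1, ?_⟩
    rw [← (hg φ hφ).2, integral_charFun_mul_fourier, integral_map hm.aemeasurable
      φ.continuous.aestronglyMeasurable]
  refine Measure.AbsolutelyContinuous.mk fun s hs hs0 => ?_
  have hc : -(2 * Real.pi) ≠ 0 := neg_ne_zero.2 (by positivity)
  have hs' : volume ((fun y : ℝ => -(2 * Real.pi) * y) ⁻¹' s) = 0 := by
    rw [Real.volume_preimage_mul_left hc, hs0, mul_zero]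
  have h2 := hac hs'
  rw [Measure.map_apply hm (hs.preimage (by fun_prop)), ← Set.preimage_comp] at h2
  have hid : (fun y : ℝ => -(2 * Real.pi) * y) ∘ (fun ω : ℝ => -ω / (2 * Real.pi)) = id := by
    ext ω
    have := Real.pi_ne_zero
    simp only [Function.comp_apply, id]
    field_simp
  rwa [hid, Set.preimage_id] at h2

/-! ### The Riemann–Lebesgue lemma for spectral measures -/

/-- The density `dμ/dω` times `e^{-ω/2}` need not be integrable here: Mathlib's Riemann–Lebesgue lemma
holds for every function, as the integrals are then zero. -/
lemma tendsto_integral_exp_of_absolutelyContinuous {μ : Measure ℝ} [IsFiniteMeasure μ]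
    (hμ : μ ≪ volume) :
    Tendsto (fun t : ℝ => ∫ ω : ℝ, Complex.exp (-(1 / 2 + Complex.I * t) * ω) ∂μ)
      (cocompact ℝ) (𝓝 0) := by
  have h := Real.tendsto_integral_exp_smul_cocompact
    (fun ω : ℝ => (μ.rnDeriv volume ω).toReal • Complex.exp (-(1 / 2) * ω))
  have h2 : Tendsto (fun t : ℝ => t * (2 * Real.pi)⁻¹) (cocompact ℝ) (cocompact ℝ) :=
    
    (Homeomorph.mulRight₀ (2 * Real.pi)⁻¹ (by positivity)).isClosedEmbedding.tendsto_cocompact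
  refine (h.comp h2).congr fun t => ?_
  rw [← integral_rnDeriv_smul hμ]
  simp only [Function.comp_apply]
  congr 1
  ext ω
  rw [smul_comm]
  congr 1
  rw [Circle.smul_def, Real.fourierChar_apply, smul_eq_mul, ← Complex.exp_add]
  congr 1
  push_cast
  field_simp
  ring

end Fourier

section Mixing

variable {M : Type*} [CStarAlgebra M] [PartialOrder M] [StarOrderedRing M] (ψ : M →ₚ[ℂ] ℂ)

/-! ### The absolutely continuous subspace -/

/-- The absolutely continuous subspace of the modular Hamiltonian: the vectors whose spectral
measure has no part singular to Lebesgue measure. -/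
def modularACSubspace : Submodule ℂ ψ.GNS where
  carrier := {v | modularSpectralMeasure ψ v ≪ volume}
  add_mem' {v w} hv hw := (modularSpectralMeasure_add_le ψ v w).absolutelyContinuous.trans
    ((hv.smul_left 2).add_left (hw.smul_left 2))
  zero_mem' := by
    have h := modularSpectralMeasure_smul ψ 0 0
    simp only [smul_zero, norm_zero, ne_eq, OfNat.ofNat_ne_zero, not_false_eq_true, zero_pow,
      ENNReal.ofReal_zero, zero_smul] at h
    rw [Set.mem_ofPred_eq, h]
    exact Measure.AbsolutelyContinuous.zero _
  smul_mem' c v hv := by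
    rw [Set.mem_ofPred_eq, modularSpectralMeasure_smul]
    exact hv.smul_left _

variable {ψ} in
lemma mem_modularACSubspace {v : ψ.GNS} :
    v ∈ modularACSubspace ψ ↔ modularSpectralMeasure ψ v ≪ volume := Iff.rfl

lemma isClosed_modularACSubspace : IsClosed (modularACSubspace ψ : Set ψ.GNS) := by
  refine isClosed_of_closure_subset fun v hv => ?_
  obtain ⟨u, hu, hlim⟩ := mem_closure_iff_seq_limit.1 hv
  refine Measure.AbsolutelyContinuous.mk fun s _ hs0 => ?_
  have hle : ∀ n, modularSpectralMeasure ψ v s ≤ 2 * ENNReal.ofReal (‖v - u n‖ ^ 2) := by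
    intro n
    have h := modularSpectralMeasure_add_le ψ (u n) (v - u n) s
    rw [add_sub_cancel] at h
    refine h.trans ?_
    have h0 : modularSpectralMeasure ψ (u n) s = 0 := mem_modularACSubspace.1 (hu n) hs0
    simp only [Measure.add_apply, Measure.smul_apply, smul_eq_mul, h0, mul_zero, zero_add]
    rw [← modularSpectralMeasure_univ]
    gcongr
    exact Set.subset_univ _
  have h1 : Tendsto (fun n => ‖v - u n‖ ^ 2) atTop (𝓝 0) := by
    have h := ((tendsto_const_nhds (x := v)).sub hlim).norm.pow 2
    simpa using h
  have h2 : Tendsto (fun n => 2 * ENNReal.ofReal (‖v - u n‖ ^ 2)) atTop (𝓝 0) := by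
    have h := ENNReal.Tendsto.const_mul (a := 2) (ENNReal.tendsto_ofReal h1) (Or.inr (by simp))
    simpa using h
  exact le_antisymm (ge_of_tendsto' h2 hle) zero_le

/-- A closed subspace of a Hilbert space is weakly sequentially closed. -/
lemma mem_of_tendsto_inner {H : Type*} [NormedAddCommGroup H] [InnerProductSpace ℂ H]
    [CompleteSpace H] {S : Submodule ℂ H} (hS : IsClosed (S : Set H)) {x : ℕ → H} {y : H}
    (hx : ∀ n, x n ∈ S) (hlim : ∀ w, Tendsto (fun n => ⟪w, x n⟫_ℂ) atTop (𝓝 ⟪w, y⟫_ℂ)) :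
    y ∈ S := by
  have : CompleteSpace S := hS.completeSpace_coe
  rw [← S.orthogonal_orthogonal, Submodule.mem_orthogonal]
  intro w hw
  refine tendsto_nhds_unique (hlim w) (tendsto_const_nhds.congr fun n => ?_)
  exact (S.inner_left_of_mem_orthogonal (hx n) hw).symm

/-! ### Modular two-point functions -/

lemma modularForm_self (ξ : ψ.GNS) (t : ℝ) :
    modularForm ψ ξ ξ t = ∫ ω : ℝ, Complex.exp (-(1 / 2 + Complex.I * t) * ω)
      ∂(modularSpectralMeasure ψ ξ) := by
  have h : ∀ k : ℕ, modularSpectralMeasure ψ (ξ + Complex.I ^ k • ξ) =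
      ENNReal.ofReal (‖1 + Complex.I ^ k‖ ^ 2) • modularSpectralMeasure ψ ξ := by
    intro k
    rw [← modularSpectralMeasure_smul, add_smul, one_smul]
  simp only [modularForm, h, integral_smul_measure,
    ← Complex.normSq_eq_norm_sq, Complex.real_smul]
  simp only [Finset.sum_range_succ, Finset.sum_range_zero, Complex.normSq_apply, pow_succ, pow_zero]
  simp
  ring

variable {ψ}

lemma norm_exp_modular (t ω : ℝ) :
    ‖Complex.exp (-(1 / 2 + Complex.I * t) * ω)‖ = Real.exp (-ω / 2) := by
  rw [Complex.norm_exp]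
  congr 1
  simp
  ring

lemma FiniteModularNorm.integrable_exp {v : ψ.GNS} (hv : FiniteModularNorm ψ v) (t : ℝ) :
    Integrable (fun ω : ℝ => Complex.exp (-(1 / 2 + Complex.I * t) * ω))
      (modularSpectralMeasure ψ v) := by
  refine Integrable.mono' hv (Continuous.aestronglyMeasurable (by fun_prop)) (ae_of_all _ fun ω => ?_)
  rw [norm_exp_modular]

lemma FiniteModularNorm.add {v w : ψ.GNS} (hv : FiniteModularNorm ψ v)
    (hw : FiniteModularNorm ψ w) : FiniteModularNorm ψ (v + w) :=
  ((hv.smul_measure (by simp)).add_measure (hw.smul_measure (by simp))).mono_measure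
    (modularSpectralMeasure_add_le ψ v w)

lemma FiniteModularNorm.smul {v : ψ.GNS} (hv : FiniteModularNorm ψ v) (c : ℂ) :
    FiniteModularNorm ψ (c • v) := by
  unfold FiniteModularNorm
  rw [modularSpectralMeasure_smul]
  exact hv.smul_measure (by simp)

/-- A vector whose modular autocorrelation has a measurable Fourier transform lies in the absolutely
continuous subspace: the autocorrelation is the characteristic function of the finite measure
`e^{-ω/2} ⟨v, dP(ω) v⟩`. -/
lemma mem_modularACSubspace_of_hasMeasurableFourierTransform {v : ψ.GNS}
    (hv : FiniteModularNorm ψ v) (hf : HasMeasurableFourierTransform (modularForm ψ v v)) :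
    v ∈ modularACSubspace ψ := by
  set μ := modularSpectralMeasure ψ v with hμ
  let d : ℝ → ENNReal := fun ω => ENNReal.ofReal (Real.exp (-ω / 2))
  have hd : Measurable d := by fun_prop
  have : IsFiniteMeasure (μ.withDensity d) := isFiniteMeasure_withDensity_ofReal hv.2
  have h1 : modularForm ψ v v = fun t : ℝ =>
      ∫ ω : ℝ, Complex.exp (-(Complex.I * t * ω)) ∂(μ.withDensity d) := by
    ext t
    rw [modularForm_self, integral_withDensity_eq_integral_toReal_smul hd
      (ae_of_all _ fun ω => ENNReal.ofReal_lt_top)]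
    congr 1
    ext ω
    rw [ENNReal.toReal_ofReal (Real.exp_nonneg _), Complex.real_smul, Complex.ofReal_exp,
      ← Complex.exp_add]
    congr 1
    push_cast
    ring
  rw [h1] at hf
  exact (withDensity_absolutelyContinuous' hd.aemeasurable
    (ae_of_all _ fun ω => by simp [d, Real.exp_pos])).trans
    (absolutelyContinuous_of_hasMeasurableFourierTransform hf)

/-- The diagonal modular function of a vector whose part orthogonal to the vacuum is absolutely
continuous tends to the squared norm of its vacuum component. -/
lemma tendsto_integral_exp_smul_vacuum_add (h1 : ψ 1 = 1) {c : ℂ} {w : ψ.GNS}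
    (hw : ⟪vacuum ψ, w⟫_ℂ = 0) (hac : w ∈ modularACSubspace ψ)
    (hfin : FiniteModularNorm ψ (c • vacuum ψ + w)) :
    Tendsto (fun t : ℝ => ∫ ω : ℝ, Complex.exp (-(1 / 2 + Complex.I * t) * ω)
      ∂(modularSpectralMeasure ψ (c • vacuum ψ + w))) (cocompact ℝ) (𝓝 (Complex.normSq c)) := by
  have h : ∀ t : ℝ, ∫ ω : ℝ, Complex.exp (-(1 / 2 + Complex.I * t) * ω)
      ∂(modularSpectralMeasure ψ (c • vacuum ψ + w)) = Complex.normSq c +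
      ∫ ω : ℝ, Complex.exp (-(1 / 2 + Complex.I * t) * ω) ∂(modularSpectralMeasure ψ w) := by
    intro t
    have hi := hfin.integrable_exp t
    rw [modularSpectralMeasure_smul_vacuum_add h1 c hw] at hi ⊢
    rw [integral_add_measure hi.left_of_add_measure hi.right_of_add_measure, integral_smul_measure,
      integral_dirac, ENNReal.toReal_ofReal (sq_nonneg _), Complex.normSq_eq_norm_sq]
    simp
  simp only [h]
  simpa using (tendsto_integral_exp_of_absolutelyContinuous hac).const_add
    ((Complex.normSq c : ℝ) : ℂ)

lemma tendsto_modularForm_smul_vacuum_add (h1 : ψ 1 = 1) {c d : ℂ} {v w : ψ.GNS}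
    (hv : ⟪vacuum ψ, v⟫_ℂ = 0) (hw : ⟪vacuum ψ, w⟫_ℂ = 0) (hvac : v ∈ modularACSubspace ψ)
    (hwac : w ∈ modularACSubspace ψ) (hvfin : FiniteModularNorm ψ (c • vacuum ψ + v))
    (hwfin : FiniteModularNorm ψ (d • vacuum ψ + w)) :
    Tendsto (modularForm ψ (c • vacuum ψ + v) (d • vacuum ψ + w)) (cocompact ℝ)
      (𝓝 (star c * d)) := by
  have hk : ∀ k : ℕ, c • vacuum ψ + v + Complex.I ^ k • (d • vacuum ψ + w) =
      (c + Complex.I ^ k * d) • vacuum ψ + (v + Complex.I ^ k • w) := by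
    intro k
    rw [smul_add, add_smul, mul_smul]
    abel
  -- polarization for the sesquilinear form `star c * d` on `ℂ`
  have hpol : star c * d = 4⁻¹ * ∑ k ∈ Finset.range 4, (-Complex.I) ^ k *
      (Complex.normSq (c + Complex.I ^ k * d) : ℂ) := by
    simp only [Finset.sum_range_succ, Finset.sum_range_zero, Complex.normSq_apply, pow_succ,
      pow_zero]
    apply Complex.ext
    · simp
      ring
    · simp
      ring
  rw [hpol]
  refine (tendsto_finsetSum _ fun k _ => Tendsto.const_mul _ ?_).const_mul _
  have hfin := hvfin.add (hwfin.smul (Complex.I ^ k))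
  rw [hk] at hfin ⊢
  refine tendsto_integral_exp_smul_vacuum_add h1 ?_
    (add_mem hvac (Submodule.smul_mem _ _ hwac)) hfin
  rw [inner_add_right, inner_smul_right, hv, hw]
  simp

/-! ### Operator systems -/

variable (ψ) in
/-- The projection `1 - |1⟩⟨1|` onto the orthogonal complement of the vacuum. -/
def vacuumComplement : ψ.GNS →ₗ[ℂ] ψ.GNS where
  toFun u := u - ⟪vacuum ψ, u⟫_ℂ • vacuum ψ
  map_add' u v := by
    rw [inner_add_right, add_smul]
    abel
  map_smul' c u := by
    rw [inner_smul_right, mul_smul, RingHom.id_apply, smul_sub]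

lemma vacuumComplement_apply (u : ψ.GNS) :
    vacuumComplement ψ u = u - ⟪vacuum ψ, u⟫_ℂ • vacuum ψ := rfl

lemma smul_vacuum_add_vacuumComplement (u : ψ.GNS) :
    ⟪vacuum ψ, u⟫_ℂ • vacuum ψ + vacuumComplement ψ u = u := by
  rw [vacuumComplement_apply, add_sub_cancel]

lemma inner_vacuum_self (h1 : ψ 1 = 1) : ⟪vacuum ψ, vacuum ψ⟫_ℂ = 1 := by
  rw [inner_self_eq_norm_sq_to_K, norm_vacuum h1]
  simp

lemma vacuumComplement_vacuum (h1 : ψ 1 = 1) : vacuumComplement ψ (vacuum ψ) = 0 := by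
  rw [vacuumComplement_apply, inner_vacuum_self h1, one_smul, sub_self]

lemma inner_vacuum_vacuumComplement (h1 : ψ 1 = 1) (u : ψ.GNS) :
    ⟪vacuum ψ, vacuumComplement ψ u⟫_ℂ = 0 := by
  rw [vacuumComplement_apply, inner_sub_right, inner_smul_right, inner_vacuum_self h1, mul_one,
    sub_self]

lemma ket_subtracted (a : M) : ket ψ (subtracted ψ a) = vacuumComplement ψ (ket ψ a) := by
  have h : subtracted ψ a = a + (-ψ a) • (1 : M) := by
    rw [subtracted, Algebra.algebraMap_eq_smul_one, neg_smul, sub_eq_add_neg]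
  rw [h, ket_add, ket_smul, vacuumComplement_apply, vacuum, inner_ket, star_one, one_mul, neg_smul,
    sub_eq_add_neg]

/-- Removing the vacuum component from the defining series of an element of the operator system
leaves a weakly convergent series of one-point subtracted observables, so the sum inherits absolute
continuity from them. -/
lemma vacuumComplement_ket_mem_modularACSubspace (h1 : ψ 1 = 1) {O : ℕ → M}
    (hO : ∀ i, ket ψ (subtracted ψ (O i)) ∈ modularACSubspace ψ) {a : VacuumOperator ψ}
    (ha : a ∈ operatorSystem ψ O) : vacuumComplement ψ a.ket ∈ modularACSubspace ψ := by
  obtain ⟨⟨α₀, α, hlim⟩, -⟩ := ha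
  let x : ℕ → ψ.GNS := fun n => α₀ • vacuum ψ + ∑ i ∈ Finset.range n, α i • ket ψ (O i)
  have hx : ∀ w, Tendsto (fun n => ⟪w, x n⟫_ℂ) atTop (𝓝 ⟪w, a.ket⟫_ℂ) := by
    intro w
    have h := hlim ⟨vacuum ψ, a.commutantDomain_le (vacuum_mem_commutantDomain ψ)⟩ w
    simp only [gnsStarAlgHom_vacuum] at h
    exact h
  refine mem_of_tendsto_inner (isClosed_modularACSubspace ψ)
    (x := fun n => vacuumComplement ψ (x n)) (fun n => ?_) fun w => ?_
  · simp only [x, map_add, map_smul, map_sum, vacuumComplement_vacuum h1, smul_zero, zero_add,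
      ← ket_subtracted]
    exact Submodule.sum_mem _ fun i _ => Submodule.smul_mem _ _ (hO i)
  · simp only [vacuumComplement_apply, inner_sub_right, inner_smul_right]
    exact (hx w).sub ((hx _).mul_const _)

end Mixing

end

theorem mainTheorem7 {M : Type*} [CStarAlgebra M] [PartialOrder M] [StarOrderedRing M]
    [WStarAlgebra M] (ψ : M →ₚ[ℂ] ℂ) (hψ : IsFaithfulNormalState ψ)
    (O : ℕ → M) (hO : ∀ i, IsSelfAdjoint (O i))
    (hf : ∀ i j, HasMeasurableFourierTransform
      (modularCorrelator ψ (subtracted ψ (O i)) (subtracted ψ (O j)))) :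
    IsMixing (operatorSystem ψ O) := by
  have h1 := hψ.map_one
  have hac : ∀ i, ket ψ (subtracted ψ (O i)) ∈ modularACSubspace ψ := fun i =>
    mem_modularACSubspace_of_hasMeasurableFourierTransform (finiteModularNorm_ket ψ _) (hf i i)
  intro a ha b hb
  suffices h : Tendsto (connectedCorrelator a b) (cocompact ℝ) (𝓝 0) from
    ⟨h.mono_left atTop_le_cocompact, h.mono_left atBot_le_cocompact⟩
  have hab : Tendsto (modularForm ψ a.ket b.ket) (cocompact ℝ)
      (𝓝 (⟪a.ket, vacuum ψ⟫_ℂ * ⟪vacuum ψ, b.ket⟫_ℂ)) := by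
    have h := tendsto_modularForm_smul_vacuum_add (c := ⟪vacuum ψ, a.ket⟫_ℂ)
      (d := ⟪vacuum ψ, b.ket⟫_ℂ) h1 (inner_vacuum_vacuumComplement h1 a.ket)
      (inner_vacuum_vacuumComplement h1 b.ket)
      (vacuumComplement_ket_mem_modularACSubspace h1 hac ha)
      (vacuumComplement_ket_mem_modularACSubspace h1 hac hb)
      (by rw [smul_vacuum_add_vacuumComplement]; exact ha.2)
      (by rw [smul_vacuum_add_vacuumComplement]; exact hb.2)
    rw [smul_vacuum_add_vacuumComplement, smul_vacuum_add_vacuumComplement] at h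
    rwa [← inner_conj_symm a.ket]
  have h := hab.sub_const (⟪a.ket, vacuum ψ⟫_ℂ * ⟪vacuum ψ, b.ket⟫_ℂ)
  rwa [sub_self] at h
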